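/- Let $L,N,M$ be integers with $N,M\ge 1$. Let $\mathcal X\subseteq\mathbb R_+^{L\times N}$ be a set of nonnegative codeword matrices, and let $\mu_{ij}\in\mathbb R$, $\sigma_{ij}>0$ for $1\le i\le N$, $1\le j\le M$. The channel $\mathbf H=(h_{ij})\in\mathbb R_+^{N\times M}$, with columns $\mathbf h_1,\dots,\mathbf h_M$, has independent log-normal entries $h_{ij}=e^{z_{ij}}$, $z_{ij}\sim\mathcal N(\mu_{ij},\sigma_{ij}^2)$. With $Q(x)=\frac1{\sqrt{2\pi}}\int_x^\infty e^{-t^2/2}\,dt$ and $\Delta\mathbf X=\mathbf X-\hat{\mathbf X}$, the average pairwise error probability (PEP) at signal-to-noise ratio $\rho$ is $$P(\mathbf X\to\hat{\mathbf X})=\mathbb E_{\mathbf H}\,Q\!\left(\tfrac12 d\right),\qquad d^2=\frac{\rho}{N}\sum_{j=1}^M\mathbf h_j^T\Delta\mathbf X^T\Delta\mathbf X\,\mathbf h_j .$$ For a positive semi-definite $\mathbf P\in\mathbb R^{N\times N}$ and $\tau>0$ let $D_\tau=\{\mathbf h\in\mathbb R_+^N:\mathbf h^T\mathbf P\mathbf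 h\le\tau^2\}$. The cover order of $\mathbf P$ is the largest $r$ for which there are $r$ distinct indices $n_1,\dots,n_r$ and constants $\bar c_{n_1},\dots,\bar c_{n_r}$, independent of $\tau$, such that $D_\tau\subseteq\{\mathbf h:0\le h_{n_k}\le\bar c_{n_k}\tau,\ k=1,\dots,r\}$ for every $\tau>0$. $\mathbf P$ has full cover if its cover order is $N$; in that case its $i$-th cover length $c_i$ is the least constant $c$ such that $h_i\le c\,\tau$ for all $\tau>0$ and all $\mathbf h\in D_\tau$. Theorem. Suppose that $\Delta\mathbf X^T\Delta\mathbf X$ has full cover for all $\mathbf X\ne\hat{\mathbf X}$ in $\mathcal X$. Then for all $\mathbf X\neq\hat{\mathbf X}$ in $\mathcal X$ there is a function $r(\rho)$ with $$r(\rho)=o\!\left(\Big(\frac{\rho}{\ln^2\rho}\Big)^{-\frac{MN}2}\exp\Big(-\frac{\Omega\ln^2\rho}{8}\Big)\right)\qquad(\rho\to\infty)$$ such that, for all sufficiently large $\rho$, $$C_L\prod_{j=1}^M\prod_{i=1}^N\frac{1-x_{ij}^{-2}}{x_{ij}}\;\exp\Big(-\sum_{j=1}^M\sum_{i=1}^N\frac{(\ln\rho+2\ln\lambda_{\max}+2\mu_{ij})^2}{8\sigma_{ij}^2}\Big)\le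 P(\mathbf X\to\hat{\mathbf X})\le P_U(\mathbf X\to\hat{\mathbf X})+r(\rho).$$ Here $x_{ij}=\frac{\ln\rho+2\ln\lambda_{\max}+2\mu_{ij}}{2\sigma_{ij}}$, $\lambda_{\max}$ is the largest eigenvalue of $\Delta\mathbf X^T\Delta\mathbf X$, $c_1,\dots,c_N$ are the cover lengths of $\Delta\mathbf X^T\Delta\mathbf X$, $$\Omega_i=\sum_{j=1}^M\sigma_{ij}^{-2},\quad \Omega=\sum_{i=1}^N\Omega_i,\quad \tilde\Omega_i=\sum_{j=1}^M\mu_{ij}\sigma_{ij}^{-2},\quad \tilde\Omega=\sum_{i=1}^N\tilde\Omega_i,$$ $$C_{\min}=\min_{\mathbf z\in\mathbb R_+^N,\ \|\mathbf z\|_2=1}\mathbf z^T\Delta\mathbf X^T\Delta\mathbf X\,\mathbf z,\qquad C_L=\frac{\sqrt{\prod_{j=1}^M\prod_{i=1}^N\sigma_{ij}^2}\;Q\big(\sqrt{M/(4N)}\big)}{\sqrt{2\pi}\,\prod_{i=1}^N\lambda_{\max}^{\tilde\Omega_i}},$$ $$P_U(\mathbf X\to\hat{\mathbf X})=C_U\Big(\frac{\rho}{\ln^2\rho}\Big)^{\frac12\ln\prod_{i=1}^Nc_i^{\Omega_i}-\frac12\Omega\ln(N\Omega)-\frac14\tilde\Omega}(\ln\rho)^{-MN}\exp\Big(-\frac{\Omega\ln^2\frac{\rho}{\ln^2\rho}}{8}\Big),$$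 $$C_U=\frac{(\Omega C_{\min}/N^2)^{-MN/2}}{2\sqrt{\prod_{j=1}^M\prod_{i=1}^N\sigma_{ij}^2}}\prod_{i=1}^Nc_i^{\tilde\Omega_i-\Omega_i\ln(N\Omega)} .$$ -/

import Mathlib

open Filter Asymptotics MeasureTheory ProbabilityTheory
open scoped Matrix

noncomputable section

namespace OWC

/-! ### Super-rectangular covers -/

/-- The nonnegative vectors `h` with `hᵀ P h ≤ τ ^ 2`. -/
def coverDomain {N : ℕ} (P : Matrix (Fin N) (Fin N) ℝ) (τ : ℝ) : Set (Fin N → ℝ) :=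
  {h | (∀ i, 0 ≤ h i) ∧ h ⬝ᵥ (P *ᵥ h) ≤ τ ^ 2}

/-- The set `s` of coordinates is a cover link of `P`: for constants `c i` (`i ∈ s`) independent of
`τ`, the domain `{h ≥ 0 : hᵀ P h ≤ τ ^ 2}` lies in the super-rectangle
`{h : 0 ≤ h i ≤ c i * τ for i ∈ s}` for every `τ > 0`. -/
def IsCoverLink {N : ℕ} (P : Matrix (Fin N) (Fin N) ℝ) (s : Finset (Fin N)) : Prop :=
  ∃ c : Fin N → ℝ, ∀ τ : ℝ, 0 < τ →
    coverDomain P τ ⊆ {h | ∀ i ∈ s, 0 ≤ h i ∧ h i ≤ c i * τ}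

/-- The cover order of `P`: the largest `r` such that `P` is `r`-covered by a super-rectangle. -/
def coverOrder {N : ℕ} (P : Matrix (Fin N) (Fin N) ℝ) : ℕ :=
  sSup {r : ℕ | ∃ s : Finset (Fin N), s.card = r ∧ IsCoverLink P s}

/-- `P` has full cover: its cover order is maximal. -/
def HasFullCover {N : ℕ} (P : Matrix (Fin N) (Fin N) ℝ) : Prop :=
  coverOrder P = N

/-- The `i`-th cover length of `P`: the least constant `c` (independent of `τ`) such that `h i ≤ c * τ` on
`{h ≥ 0 : hᵀ P h ≤ τ ^ 2}` for every `τ > 0`. -/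
def coverLength {N : ℕ} (P : Matrix (Fin N) (Fin N) ℝ) (i : Fin N) : ℝ :=
  sInf {c : ℝ | ∀ τ : ℝ, 0 < τ → ∀ h ∈ coverDomain P τ, h i ≤ c * τ}

/-- The minimum of `zᵀ P z` over the nonnegative unit vectors `z`. -/
def coneMin {N : ℕ} (P : Matrix (Fin N) (Fin N) ℝ) : ℝ :=
  sInf ((fun z : Fin N → ℝ => z ⬝ᵥ (P *ᵥ z)) '' {z | (∀ i, 0 ≤ z i) ∧ ∑ i, z i ^ 2 = 1})

/-- The maximum (real) eigenvalue of `P`. -/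
def maxEigenvalue {N : ℕ} (P : Matrix (Fin N) (Fin N) ℝ) : ℝ :=
  sSup {l : ℝ | Module.End.HasEigenvalue (Matrix.toLin' P) l}

/-! ### Pairwise error probability over log-normal channels -/

/-- The Gaussian tail function `Q(x) = (2π)^{-1/2} ∫_x^∞ exp(-t²/2) dt`. -/
def gaussianQ (x : ℝ) : ℝ :=
  (Real.sqrt (2 * Real.pi))⁻¹ * ∫ t in Set.Ioi x, Real.exp (-t ^ 2 / 2)

/-- The law of the log-normal `N × M` channel: the entries `h i j = exp (z i j)` are independent with
`z i j` Gaussian of mean `μ i j` and variance `σ i j ^ 2`. -/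
def channelLaw {N M : ℕ} (μ σ : Fin N → Fin M → ℝ) : Measure (Fin N → Fin M → ℝ) :=
  Measure.pi fun i => Measure.pi fun j =>
    (gaussianReal (μ i j) (Real.toNNReal (σ i j ^ 2))).map Real.exp

/-- The distance between `X` and `X'` seen through the channel `H` at signal-to-noise ratio `ρ`:
`d² = (ρ / N) ∑ⱼ hⱼᵀ (X - X')ᵀ (X - X') hⱼ`, with `hⱼ` the `j`-th column of `H`. -/
def pepDist {L N M : ℕ} (X X' : Matrix (Fin L) (Fin N) ℝ) (ρ : ℝ) (H : Fin N → Fin M → ℝ) : ℝ :=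
  Real.sqrt (ρ / N * ∑ j : Fin M,
    (fun i => H i j) ⬝ᵥ (((X - X')ᵀ * (X - X')) *ᵥ fun i => H i j))

/-- The pairwise error probability `P(X → X' | H) = Q(d / 2)` of the maximum likelihood receiver. -/
def condPEP {L N M : ℕ} (X X' : Matrix (Fin L) (Fin N) ℝ) (ρ : ℝ) (H : Fin N → Fin M → ℝ) : ℝ :=
  gaussianQ (pepDist X X' ρ H / 2)

/-- The average pairwise error probability `P(X → X')` over the log-normal channel. -/
def avgPEP {L N M : ℕ} (μ σ : Fin N → Fin M → ℝ) (X X' : Matrix (Fin L) (Fin N) ℝ) (ρ : ℝ) : ℝ :=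
  ∫ H, condPEP X X' ρ H ∂(channelLaw μ σ)

/-! ### The constants and the bounds -/

section Bounds

/-- `Ω_i = ∑ⱼ σ_{ij}^{-2}`. -/
def Om {N M : ℕ} (σ : Fin N → Fin M → ℝ) (i : Fin N) : ℝ := ∑ j, (σ i j ^ 2)⁻¹

/-- `Ω = ∑ᵢ Ω_i`. -/
def OmTot {N M : ℕ} (σ : Fin N → Fin M → ℝ) : ℝ := ∑ i, Om σ i

/-- `Ω̃_i = ∑ⱼ μ_{ij} σ_{ij}^{-2}`. -/
def OmT {N M : ℕ} (μ σ : Fin N → Fin M → ℝ) (i : Fin N) : ℝ := ∑ j, μ i j * (σ i j ^ 2)⁻¹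

/-- `Ω̃ = ∑ᵢ Ω̃_i`. -/
def OmTTot {N M : ℕ} (μ σ : Fin N → Fin M → ℝ) : ℝ := ∑ i, OmT μ σ i

/-- The constant `C_L`, for `P = ΔXᵀ ΔX`. -/
def constL {N M : ℕ} (μ σ : Fin N → Fin M → ℝ) (P : Matrix (Fin N) (Fin N) ℝ) : ℝ :=
  Real.sqrt (∏ j, ∏ i, σ i j ^ 2) * gaussianQ (Real.sqrt ((M : ℝ) / (4 * N))) /
    (Real.sqrt (2 * Real.pi) * ∏ i, maxEigenvalue P ^ OmT μ σ i)

/-- `(ln ρ + 2 ln λ_max + 2 μ_{ij}) / (2 σ_{ij})`, for `P = ΔXᵀ ΔX`. -/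
def lowerArg {N M : ℕ} (μ σ : Fin N → Fin M → ℝ) (P : Matrix (Fin N) (Fin N) ℝ) (ρ : ℝ)
    (i : Fin N) (j : Fin M) : ℝ :=
  (Real.log ρ + 2 * Real.log (maxEigenvalue P) + 2 * μ i j) / (2 * σ i j)

/-- The lower bound, for `P = ΔXᵀ ΔX`. -/
def lowerBound {N M : ℕ} (μ σ : Fin N → Fin M → ℝ) (P : Matrix (Fin N) (Fin N) ℝ) (ρ : ℝ) : ℝ :=
  constL μ σ P *
    (∏ j, ∏ i, (1 - (lowerArg μ σ P ρ i j ^ 2)⁻¹) / lowerArg μ σ P ρ i j) *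
    Real.exp (-∑ j, ∑ i,
      (Real.log ρ + 2 * Real.log (maxEigenvalue P) + 2 * μ i j) ^ 2 / (8 * σ i j ^ 2))

/-- The constant `C_U`, for `P = ΔXᵀ ΔX`. -/
def constU {N M : ℕ} (μ σ : Fin N → Fin M → ℝ) (P : Matrix (Fin N) (Fin N) ℝ) : ℝ :=
  (OmTot σ * coneMin P / (N : ℝ) ^ 2) ^ (-((M : ℝ) * N / 2)) /
      (2 * Real.sqrt (∏ j, ∏ i, σ i j ^ 2)) *
    ∏ i, coverLength P i ^ (OmT μ σ i - Om σ i * Real.log (N * OmTot σ))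

/-- The main term `P_U` of the upper bound, for `P = ΔXᵀ ΔX`. -/
def upperMain {N M : ℕ} (μ σ : Fin N → Fin M → ℝ) (P : Matrix (Fin N) (Fin N) ℝ) (ρ : ℝ) : ℝ :=
  constU μ σ P *
    (ρ / Real.log ρ ^ 2) ^
      (1 / 2 * Real.log (∏ i, coverLength P i ^ Om σ i)
        - 1 / 2 * OmTot σ * Real.log (N * OmTot σ) - 1 / 4 * OmTTot μ σ) *
    Real.log ρ ^ (-((M : ℝ) * N)) *
    Real.exp (-(OmTot σ * Real.log (ρ / Real.log ρ ^ 2) ^ 2 / 8))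

/-- The scale of the remainder, `(ρ / ln² ρ)^{-MN/2} exp(-Ω ln² ρ / 8)`. -/
def remainderScale {N M : ℕ} (σ : Fin N → Fin M → ℝ) (ρ : ℝ) : ℝ :=
  (ρ / Real.log ρ ^ 2) ^ (-((M : ℝ) * N / 2)) *
    Real.exp (-(OmTot σ * Real.log ρ ^ 2 / 8))

end Bounds

end OWC

end

/-!
# Error probability of full-cover codes over log-normal channels

Write `ℓ = ln ρ` and `P = ΔXᵀ ΔX`. The average pairwise error probability turns out to be at most
`exp (-Ω ℓ ^ 2 / 8 + Ω ℓ ln ℓ / 4 + O(ℓ))`, whereas `upperMain` is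
`exp (-Ω ℓ ^ 2 / 8 + Ω ℓ ln ℓ / 2 + O(ℓ))`. The gap `Ω ℓ ln ℓ / 4` absorbs all terms of order `ℓ`
(`eventually_le_mul_log`), so the upper bound holds for large `ρ` already with remainder `r = 0`,
whatever the exact power of `ρ / ln² ρ` and the exact value of the positive constant `constU`.

*Upper bound.* Full cover makes `hᵀ P h` dominate `m ‖h‖ ^ 2` on the nonnegative orthant for some
`m > 0` (`HasFullCover.exists_pos_mul_sum_sq_le`). With `Q x ≤ √2 exp (-x ^ 2 / 4)` the average then
factorizes over the independent entries into integrals of `exp (-b h ^ 2)` with `b` proportional to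
`ρ` (`avgPEP_le_prod`). Each of them is bounded by a negative moment of the log-normal variable,
whose order `2 θ` is chosen to minimise the exponent (`integral_exp_neg_mul_exp_le`).

*Lower bound.* On the event that every entry satisfies `h_ij ≤ exp (μ_ij - σ_ij (x_ij - 2))`, which
is a constant times `ρ ^ (-1 / 2)`, the conditional error probability is bounded below
(`exists_pos_le_condPEP`), and the event has probability at least a constant times
`∏ exp (-(x_ij - 1) ^ 2 / 2)` (`le_gaussianReal_Iic`). This beats `∏ exp (-x_ij ^ 2 / 2)` by the
unbounded factor `exp (∑ (x_ij - 1 / 2))`, which absorbs the constants.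
-/

namespace OWC

/-! ### Quadratic forms with full cover -/

theorem HasFullCover.isCoverLink_univ {N : ℕ} {P : Matrix (Fin N) (Fin N) ℝ}
    (hP : HasFullCover P) : IsCoverLink P Finset.univ := by
  have hmem : coverOrder P ∈ {r : ℕ | ∃ s : Finset (Fin N), s.card = r ∧ IsCoverLink P s} := by
    refine Nat.sSup_mem ⟨0, ∅, rfl, 0, fun τ _ h _ i hi => absurd hi (Finset.notMem_empty i)⟩
      ⟨N, ?_⟩
    rintro r ⟨s, rfl, -⟩
    simpa using s.card_le_univ
  obtain ⟨s, hs, hlink⟩ := hmem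
  have : s = Finset.univ := by
    rw [← Finset.card_eq_iff_eq_univ, hs, hP, Fintype.card_fin]
  rwa [← this]

/-- Full cover forces the quadratic form to dominate a multiple of the squared norm on the
nonnegative orthant. -/
theorem HasFullCover.exists_pos_mul_sum_sq_le {N : ℕ} {P : Matrix (Fin N) (Fin N) ℝ}
    (hP : HasFullCover P) :
    ∃ m : ℝ, 0 < m ∧ ∀ h : Fin N → ℝ, (∀ i, 0 ≤ h i) → m * ∑ i, h i ^ 2 ≤ h ⬝ᵥ (P *ᵥ h) := by
  obtain ⟨c, hc⟩ := hP.isCoverLink_univ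
  have hS : 0 ≤ ∑ i, c i ^ 2 := Finset.sum_nonneg fun i _ => sq_nonneg _
  refine ⟨(∑ i, c i ^ 2 + 1)⁻¹, by positivity, fun h hh => ?_⟩
  by_contra! hlt
  rcases (Finset.sum_nonneg fun i _ => sq_nonneg (h i) : 0 ≤ ∑ i, h i ^ 2).eq_or_lt with h0 | hpos
  · have hz : h = 0 := by
      funext i
      have := (Finset.sum_eq_zero_iff_of_nonneg fun i _ => sq_nonneg (h i)).1 h0.symm i
        (Finset.mem_univ i)
      simpa using this
    subst hz
    simp at hlt
  · -- the radius `τ` for which `h` lies in the domain but is too long for the rectangle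
    set τ := Real.sqrt ((∑ i, c i ^ 2 + 1)⁻¹ * ∑ i, h i ^ 2) with hτ
    have hτ0 : 0 < τ := Real.sqrt_pos.2 (by positivity)
    have hτ2 : τ ^ 2 = (∑ i, c i ^ 2 + 1)⁻¹ * ∑ i, h i ^ 2 := Real.sq_sqrt (by positivity)
    have hle : ∑ i, h i ^ 2 ≤ (∑ i, c i ^ 2) * τ ^ 2 := by
      rw [Finset.sum_mul]
      refine Finset.sum_le_sum fun i _ => ?_
      rw [← mul_pow]
      exact pow_le_pow_left₀ (hh i)
        (hc τ hτ0 ⟨hh, hτ2 ▸ hlt.le⟩ i (Finset.mem_univ i)).2 2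
    have : ∑ i, h i ^ 2 = (∑ i, c i ^ 2 + 1) * τ ^ 2 := by
      rw [hτ2]; field_simp
    nlinarith [pow_pos hτ0 2]

theorem HasFullCover.coneMin_pos {N : ℕ} (hN : 0 < N) {P : Matrix (Fin N) (Fin N) ℝ}
    (hP : HasFullCover P) : 0 < coneMin P := by
  obtain ⟨m, hm, hle⟩ := hP.exists_pos_mul_sum_sq_le
  refine hm.trans_le (le_csInf ?_ ?_)
  · refine ⟨_, Pi.single ⟨0, hN⟩ 1, ⟨fun i => ?_, ?_⟩, rfl⟩
    · by_cases hi : i = ⟨0, hN⟩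
      · subst hi; simp
      · simp [Pi.single_eq_of_ne hi]
    · simp [Pi.single_apply]
  · rintro _ ⟨z, ⟨hz, hz1⟩, rfl⟩
    simpa [hz1] using hle z hz

theorem HasFullCover.coverLength_pos {N : ℕ} {P : Matrix (Fin N) (Fin N) ℝ}
    (hP : HasFullCover P) (i : Fin N) : 0 < coverLength P i := by
  obtain ⟨c, hc⟩ := hP.isCoverLink_univ
  -- a point of the domain with `τ = 1` on the `i`-th coordinate axis
  set t : ℝ := (Real.sqrt (|P i i| + 1))⁻¹ with ht
  have ht0 : 0 < t := by positivity
  have ht2 : t ^ 2 = (|P i i| + 1)⁻¹ := by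
    rw [ht, inv_pow, Real.sq_sqrt (by positivity)]
  refine ht0.trans_le (le_csInf ⟨c i, fun τ hτ h hh => (hc τ hτ hh i (Finset.mem_univ i)).2⟩ ?_)
  intro b hb
  have hmem : (Pi.single i t : Fin N → ℝ) ∈ coverDomain P 1 := by
    refine ⟨fun k => ?_, ?_⟩
    · by_cases hk : k = i
      · subst hk; simpa using ht0.le
      · simp [Pi.single_eq_of_ne hk]
    · have : (Pi.single i t : Fin N → ℝ) ⬝ᵥ (P *ᵥ Pi.single i t) = P i i * t ^ 2 := by
        simp [Matrix.mulVec_single, single_dotProduct]; ring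
      rw [this, ht2, one_pow, ← div_eq_mul_inv, div_le_one (by positivity)]
      linarith [le_abs_self (P i i)]
  simpa using hb 1 one_pos _ hmem

theorem HasFullCover.constU_pos {N M : ℕ} (hN : 0 < N) (hM : 0 < M) {μ σ : Fin N → Fin M → ℝ}
    (hσ : ∀ i j, 0 < σ i j) {P : Matrix (Fin N) (Fin N) ℝ} (hP : HasFullCover P) :
    0 < constU μ σ P := by
  have : Nonempty (Fin N) := ⟨⟨0, hN⟩⟩
  have : Nonempty (Fin M) := ⟨⟨0, hM⟩⟩
  have hO : 0 < OmTot σ := Finset.sum_pos (fun i _ => Finset.sum_pos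
    (fun j _ => inv_pos.2 (pow_pos (hσ i j) 2)) Finset.univ_nonempty) Finset.univ_nonempty
  have hC := hP.coneMin_pos hN
  have hN' : (0 : ℝ) < N := by exact_mod_cast hN
  unfold constU
  refine mul_pos (div_pos (Real.rpow_pos_of_pos (by positivity) _) ?_)
    (Finset.prod_pos fun i _ => Real.rpow_pos_of_pos (hP.coverLength_pos i) _)
  exact mul_pos two_pos (Real.sqrt_pos.2
    (Finset.prod_pos fun j _ => Finset.prod_pos fun i _ => pow_pos (hσ i j) 2))

/-! ### The Gaussian tail function and Gaussian estimates -/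

theorem integrable_exp_neg_sq_div {b : ℝ} (hb : 0 < b) :
    Integrable fun t : ℝ => Real.exp (-t ^ 2 / b) := by
  convert integrable_exp_neg_mul_sq (inv_pos.2 hb) using 3
  ring

theorem gaussianQ_nonneg (x : ℝ) : 0 ≤ gaussianQ x :=
  mul_nonneg (by positivity) (integral_nonneg fun _ => (Real.exp_pos _).le)

theorem gaussianQ_antitone : Antitone gaussianQ := fun x y hxy =>
  mul_le_mul_of_nonneg_left
    (setIntegral_mono_set (integrable_exp_neg_sq_div two_pos).integrableOn
      (ae_of_all _ fun _ => (Real.exp_pos _).le) (Set.Ioi_subset_Ioi hxy).eventuallyLE)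
    (by positivity)

theorem gaussianQ_pos (x : ℝ) : 0 < gaussianQ x := by
  refine mul_pos (by positivity) ?_
  rw [setIntegral_pos_iff_support_of_nonneg_ae (ae_of_all _ fun _ => (Real.exp_pos _).le)
    (integrable_exp_neg_sq_div two_pos).integrableOn]
  have : (Function.support fun t : ℝ => Real.exp (-t ^ 2 / 2)) = Set.univ := by
    ext t; simp [Real.exp_ne_zero]
  simp [this]

theorem gaussianQ_le_exp {x : ℝ} (hx : 0 ≤ x) :
    gaussianQ x ≤ Real.sqrt 2 * Real.exp (-x ^ 2 / 4) := by
  have h4 := integrable_exp_neg_sq_div (b := 4) (by norm_num)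
  have key : ∫ t in Set.Ioi x, Real.exp (-t ^ 2 / 2) ≤
      Real.exp (-x ^ 2 / 4) * Real.sqrt (Real.pi * 4) := by
    calc ∫ t in Set.Ioi x, Real.exp (-t ^ 2 / 2)
        ≤ ∫ t in Set.Ioi x, Real.exp (-x ^ 2 / 4) * Real.exp (-t ^ 2 / 4) := by
          refine setIntegral_mono_on (integrable_exp_neg_sq_div two_pos).integrableOn
            (h4.const_mul _).integrableOn measurableSet_Ioi fun t ht => ?_
          rw [← Real.exp_add, Real.exp_le_exp]
          nlinarith [Set.mem_Ioi.1 ht]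
      _ ≤ ∫ t : ℝ, Real.exp (-x ^ 2 / 4) * Real.exp (-t ^ 2 / 4) :=
          setIntegral_le_integral (h4.const_mul _) (ae_of_all _ fun _ => by positivity)
      _ = Real.exp (-x ^ 2 / 4) * Real.sqrt (Real.pi * 4) := by
          rw [integral_const_mul]
          congr 1
          have h := integral_gaussian (4⁻¹ : ℝ)
          rw [div_inv_eq_mul] at h
          rw [← h]
          refine integral_congr_ae (ae_of_all _ fun t => ?_)
          simp only
          congr 1
          ring
  have hs : Real.sqrt (Real.pi * 4) = Real.sqrt 2 * Real.sqrt (2 * Real.pi) := by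
    rw [← Real.sqrt_mul (by norm_num)]; congr 1; ring
  have hpos : 0 < Real.sqrt (2 * Real.pi) := by positivity
  calc gaussianQ x ≤ (Real.sqrt (2 * Real.pi))⁻¹ *
        (Real.exp (-x ^ 2 / 4) * Real.sqrt (Real.pi * 4)) :=
        mul_le_mul_of_nonneg_left key (by positivity)
    _ = Real.sqrt 2 * Real.exp (-x ^ 2 / 4) := by rw [hs]; field_simp

/-- A lower bound for the Gaussian tail below `m - s (x - 2)`, from the part of the density over an
interval of length `s`. -/
theorem le_gaussianReal_Iic (m : ℝ) {s x : ℝ} (hs : 0 < s) (hx : 2 ≤ x) :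
    (Real.sqrt (2 * Real.pi))⁻¹ * Real.exp (-(x - 1) ^ 2 / 2) ≤
      (gaussianReal m (Real.toNNReal (s ^ 2))).real (Set.Iic (m - s * (x - 2))) := by
  set v := Real.toNNReal (s ^ 2) with hv
  have hvs : (v : ℝ) = s ^ 2 := Real.coe_toNNReal _ (by positivity)
  have hv0 : v ≠ 0 := by
    rw [← NNReal.coe_ne_zero, hvs]; positivity
  have hsub : Set.Icc (m - s * (x - 1)) (m - s * (x - 2)) ⊆ Set.Iic (m - s * (x - 2)) :=
    Set.Icc_subset_Iic_self
  refine le_trans ?_ (measureReal_mono hsub)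
  have hdens : ∀ z ∈ Set.Icc (m - s * (x - 1)) (m - s * (x - 2)),
      (Real.sqrt (2 * Real.pi * s ^ 2))⁻¹ * Real.exp (-(x - 1) ^ 2 / 2) ≤
        gaussianPDFReal m v z := by
    rintro z ⟨hz1, hz2⟩
    rw [gaussianPDFReal, hvs]
    refine mul_le_mul_of_nonneg_left (Real.exp_le_exp.2 ?_) (by positivity)
    rw [div_le_div_iff₀ (by norm_num) (by positivity)]
    have h0 : 0 ≤ s * (x - 2) := mul_nonneg hs.le (by linarith)
    have : (m - z) ^ 2 ≤ (s * (x - 1)) ^ 2 := pow_le_pow_left₀ (by linarith) (by linarith) 2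
    nlinarith
  rw [Measure.real, gaussianReal_apply_eq_integral m hv0, ENNReal.toReal_ofReal
    (integral_nonneg fun z => gaussianPDFReal_nonneg _ _ _)]
  calc (Real.sqrt (2 * Real.pi))⁻¹ * Real.exp (-(x - 1) ^ 2 / 2)
      = ∫ _ in Set.Icc (m - s * (x - 1)) (m - s * (x - 2)),
          (Real.sqrt (2 * Real.pi * s ^ 2))⁻¹ * Real.exp (-(x - 1) ^ 2 / 2) := by
        rw [setIntegral_const, Real.volume_real_Icc_of_le (by nlinarith), smul_eq_mul,
          Real.sqrt_mul (x := 2 * Real.pi) (by positivity) (s ^ 2), Real.sqrt_sq hs.le]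
        field_simp
        ring
    _ ≤ _ := setIntegral_mono_on (integrableOn_const (by simp))
        (integrable_gaussianPDFReal m v).integrableOn measurableSet_Icc hdens

/-- Chernoff-type bound for the Laplace transform of a squared log-normal variable. The integrand
`exp (-y)` is replaced by the larger `(θ / e) ^ θ * y ^ (-θ)`, whose expectation is a value of the
Gaussian moment generating function. -/
theorem integral_exp_neg_mul_exp_le (m : ℝ) (v : NNReal) {b θ : ℝ} (hb : 0 < b) (hθ : 0 < θ) :
    ∫ z, Real.exp (-(b * Real.exp z ^ 2)) ∂(gaussianReal m v) ≤
      Real.exp (θ * Real.log θ - θ - θ * Real.log b - 2 * θ * m + 2 * θ ^ 2 * v) := by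
  have hpt : ∀ z : ℝ, Real.exp (-(b * Real.exp z ^ 2)) ≤
      Real.exp (θ * Real.log θ - θ - θ * Real.log b) * Real.exp ((-2 * θ) * z) := by
    intro z
    rw [← Real.exp_add, Real.exp_le_exp]
    have h1 := Real.log_le_sub_one_of_pos (x := b * Real.exp z ^ 2 / θ) (by positivity)
    rw [Real.log_div (by positivity) hθ.ne', Real.log_mul hb.ne' (by positivity),
      Real.log_pow, Real.log_exp] at h1
    have h2 := mul_le_mul_of_nonneg_left h1 hθ.le
    have h3 : θ * (b * Real.exp z ^ 2 / θ - 1) = b * Real.exp z ^ 2 - θ := by field_simp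
    rw [h3] at h2
    push_cast at h2
    linarith
  calc ∫ z, Real.exp (-(b * Real.exp z ^ 2)) ∂(gaussianReal m v)
      ≤ ∫ z, Real.exp (θ * Real.log θ - θ - θ * Real.log b) * Real.exp ((-2 * θ) * z)
          ∂(gaussianReal m v) :=
        integral_mono_of_nonneg (ae_of_all _ fun _ => (Real.exp_pos _).le)
          ((integrable_exp_mul_gaussianReal _).const_mul _) (ae_of_all _ hpt)
    _ = _ := by
        rw [integral_const_mul]
        have := congrFun (mgf_id_gaussianReal (μ := m) (v := v)) (-2 * θ)
        rw [mgf] at this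
        simp only [id] at this
        rw [this, ← Real.exp_add]
        congr 1
        ring

end OWC

namespace OWC

/-! ### The channel law -/

instance isProbabilityMeasure_map_exp_gaussianReal (m : ℝ) (v : NNReal) :
    IsProbabilityMeasure ((gaussianReal m v).map Real.exp) :=
  Measure.isProbabilityMeasure_map Real.measurable_exp.aemeasurable

instance isProbabilityMeasure_channelLaw {N M : ℕ} (μ σ : Fin N → Fin M → ℝ) :
    IsProbabilityMeasure (channelLaw μ σ) := by
  unfold channelLaw; infer_instance

theorem ae_channelLaw_nonneg {N M : ℕ} (μ σ : Fin N → Fin M → ℝ) :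
    ∀ᵐ H ∂(channelLaw μ σ), ∀ i j, 0 ≤ H i j := by
  refine ae_all_iff.2 fun i => ?_
  unfold channelLaw
  refine (Measure.quasiMeasurePreserving_eval (fun i => Measure.pi fun j =>
    (gaussianReal (μ i j) (Real.toNNReal (σ i j ^ 2))).map Real.exp) i).ae
    (p := fun h => ∀ j, 0 ≤ h j) ?_
  refine ae_all_iff.2 fun j => (Measure.quasiMeasurePreserving_eval (fun j =>
    (gaussianReal (μ i j) (Real.toNNReal (σ i j ^ 2))).map Real.exp) j).ae
    (p := fun y => 0 ≤ y) ?_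
  rw [ae_map_iff Real.measurable_exp.aemeasurable measurableSet_Ici]
  exact ae_of_all _ fun z => (Real.exp_pos z).le

theorem integral_channelLaw_prod {N M : ℕ} (μ σ : Fin N → Fin M → ℝ) {f : ℝ → ℝ}
    (hf : Measurable f) :
    ∫ H, ∏ i, ∏ j, f (H i j) ∂(channelLaw μ σ) =
      ∏ i, ∏ j, ∫ z, f (Real.exp z) ∂(gaussianReal (μ i j) (Real.toNNReal (σ i j ^ 2))) := by
  unfold channelLaw
  rw [integral_fintype_prod_eq_prod (fun i (h : Fin M → ℝ) => ∏ j, f (h j))]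
  refine Finset.prod_congr rfl fun i _ => ?_
  rw [integral_fintype_prod_eq_prod (fun j (y : ℝ) => f y)]
  exact Finset.prod_congr rfl fun j _ =>
    integral_map Real.measurable_exp.aemeasurable hf.aestronglyMeasurable

theorem channelLaw_real_rectangle {N M : ℕ} (μ σ t : Fin N → Fin M → ℝ) :
    (channelLaw μ σ).real
        (Set.univ.pi fun i => Set.univ.pi fun j => Set.Ioc 0 (Real.exp (t i j))) =
      ∏ i, ∏ j, (gaussianReal (μ i j) (Real.toNNReal (σ i j ^ 2))).real (Set.Iic (t i j)) := by
  unfold channelLaw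
  rw [Measure.real, Measure.pi_pi, ENNReal.toReal_prod]
  refine Finset.prod_congr rfl fun i _ => ?_
  rw [Measure.pi_pi, ENNReal.toReal_prod]
  refine Finset.prod_congr rfl fun j _ => ?_
  rw [Measure.map_apply Real.measurable_exp measurableSet_Ioc, Measure.real]
  congr 2
  ext z
  simp [Real.exp_pos]

theorem measurable_condPEP {L N M : ℕ} (X X' : Matrix (Fin L) (Fin N) ℝ) (ρ : ℝ) :
    Measurable (condPEP (M := M) X X' ρ) := by
  refine gaussianQ_antitone.measurable.comp ?_
  unfold pepDist
  simp only [dotProduct, Matrix.mulVec]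
  fun_prop

theorem integrable_condPEP {L N M : ℕ} (μ σ : Fin N → Fin M → ℝ)
    (X X' : Matrix (Fin L) (Fin N) ℝ) (ρ : ℝ) :
    Integrable (condPEP X X' ρ) (channelLaw μ σ) := by
  refine Integrable.of_bound (measurable_condPEP X X' ρ).aestronglyMeasurable (gaussianQ 0)
    (ae_of_all _ fun H => ?_)
  rw [condPEP, Real.norm_of_nonneg (gaussianQ_nonneg _)]
  exact gaussianQ_antitone (div_nonneg (Real.sqrt_nonneg _) two_pos.le)

/-! ### Upper bound for the average error probability -/

theorem avgPEP_le_prod {L N M : ℕ} (μ σ : Fin N → Fin M → ℝ) {X X' : Matrix (Fin L) (Fin N) ℝ}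
    {m : ℝ} (hm : 0 < m)
    (hP : ∀ h : Fin N → ℝ, (∀ i, 0 ≤ h i) →
      m * ∑ i, h i ^ 2 ≤ h ⬝ᵥ (((X - X')ᵀ * (X - X')) *ᵥ h)) {ρ : ℝ} (hρ : 0 < ρ) :
    avgPEP μ σ X X' ρ ≤ Real.sqrt 2 * ∏ i, ∏ j, ∫ z,
      Real.exp (-(m * ρ / (16 * N) * Real.exp z ^ 2))
        ∂(gaussianReal (μ i j) (Real.toNNReal (σ i j ^ 2))) := by
  rw [← integral_channelLaw_prod μ σ (f := fun y => Real.exp (-(m * ρ / (16 * N) * y ^ 2)))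
    (by fun_prop), ← integral_const_mul]
  refine integral_mono_ae (integrable_condPEP μ σ X X' ρ) ?_ ?_
  · refine Integrable.const_mul (Integrable.of_bound
      (Measurable.aestronglyMeasurable (by fun_prop)) 1 (ae_of_all _ fun H => ?_)) _
    rw [Real.norm_of_nonneg (by positivity)]
    refine Finset.prod_le_one (fun i _ => by positivity) fun i _ =>
      Finset.prod_le_one (fun j _ => by positivity) fun j _ => Real.exp_le_one_iff.2 ?_
    exact neg_nonpos.2 (by positivity)
  · filter_upwards [ae_channelLaw_nonneg μ σ] with H hH
    refine (gaussianQ_le_exp (div_nonneg (Real.sqrt_nonneg _) two_pos.le)).trans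
      (mul_le_mul_of_nonneg_left ?_ (by positivity))
    simp only [← Real.exp_sum]
    rw [Real.exp_le_exp]
    have hcol : m * ∑ j, ∑ i, H i j ^ 2 ≤ ∑ j : Fin M,
        (fun i => H i j) ⬝ᵥ (((X - X')ᵀ * (X - X')) *ᵥ fun i => H i j) := by
      rw [Finset.mul_sum]
      exact Finset.sum_le_sum fun j _ => hP _ fun i => hH i j
    have h0 : 0 ≤ m * ∑ j, ∑ i, H i j ^ 2 := by positivity
    rw [div_pow, Real.sq_sqrt (mul_nonneg (by positivity) (h0.trans hcol))]
    simp only [Finset.sum_neg_distrib, ← Finset.mul_sum]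
    rw [Finset.sum_comm]
    have := mul_le_mul_of_nonneg_left hcol (show 0 ≤ ρ / N / 16 by positivity)
    have e : m * ρ / (16 * N) * ∑ j, ∑ i, H i j ^ 2 =
        ρ / N / 16 * (m * ∑ j, ∑ i, H i j ^ 2) := by
      rw [mul_comm (16 : ℝ), ← div_div]; ring
    rw [e]
    linarith

/-- The average error probability is at most
`exp (-Ω ln² ρ / 8 + Ω (ln ρ) (ln ln ρ) / 4 + O(ln ρ))`. -/
theorem exists_avgPEP_le_exp {L N M : ℕ} (hN : 0 < N) (μ : Fin N → Fin M → ℝ)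
    {σ : Fin N → Fin M → ℝ} (hσ : ∀ i j, 0 < σ i j) {X X' : Matrix (Fin L) (Fin N) ℝ}
    (hP : HasFullCover ((X - X')ᵀ * (X - X'))) :
    ∃ K : ℝ, ∀ᶠ ρ in atTop, avgPEP μ σ X X' ρ ≤ Real.sqrt 2 *
      Real.exp (-(OmTot σ * Real.log ρ ^ 2 / 8) +
        OmTot σ * (Real.log ρ * Real.log (Real.log ρ)) / 4 + K * Real.log ρ) := by
  obtain ⟨m, hm, hle⟩ := hP.exists_pos_mul_sum_sq_le
  have hN' : (0 : ℝ) < N := by exact_mod_cast hN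
  refine ⟨∑ i, ∑ j, (-(Real.log (4 * σ i j ^ 2) + 1 + Real.log (m / (16 * N)) + 2 * μ i j)) *
    (4 * σ i j ^ 2)⁻¹, ?_⟩
  filter_upwards [eventually_gt_atTop 1] with ρ hρ
  have hρ0 : 0 < ρ := one_pos.trans hρ
  have hl : 0 < Real.log ρ := Real.log_pos hρ
  refine (avgPEP_le_prod μ σ hm hle hρ0).trans (mul_le_mul_of_nonneg_left ?_ (by positivity))
  -- `θ = ln ρ / (4 σ ^ 2)` minimises `-θ ln ρ + 2 θ ^ 2 σ ^ 2`, the quadratic part of the exponent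
  have hb : 0 < m * ρ / (16 * N) := by positivity
  have hstep := fun i j => integral_exp_neg_mul_exp_le (μ i j) (Real.toNNReal (σ i j ^ 2)) hb
    (show 0 < Real.log ρ / (4 * σ i j ^ 2) from div_pos hl (by have := hσ i j; positivity))
  refine (Finset.prod_le_prod
    (fun i _ => Finset.prod_nonneg fun j _ => integral_nonneg fun _ => (Real.exp_pos _).le)
    fun i _ => Finset.prod_le_prod (fun j _ => integral_nonneg fun _ => (Real.exp_pos _).le)
    fun j _ => hstep i j).trans_eq ?_
  simp only [← Real.exp_sum]
  congr 1
  simp only [OmTot, Om, Finset.sum_mul, Finset.sum_div, ← Finset.sum_neg_distrib,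
    ← Finset.sum_add_distrib]
  refine Finset.sum_congr rfl fun i _ => Finset.sum_congr rfl fun j _ => ?_
  have hs := hσ i j
  have hb' : m * ρ / (16 * N) = m / (16 * N) * ρ := by ring
  rw [Real.coe_toNNReal _ (by positivity), Real.log_div hl.ne' (by positivity), hb',
    Real.log_mul (by positivity) hρ0.ne']
  field_simp
  ring

theorem eventually_le_mul_log (A B C D : ℝ) {ε : ℝ} (hε : 0 < ε) :
    ∀ᶠ x : ℝ in atTop,
      A + B * x + C * Real.log x + D * Real.log x ^ 2 ≤ ε * (x * Real.log x) := by
  have hlog : Tendsto Real.log atTop atTop := Real.tendsto_log_atTop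
  have h1 : (fun _ : ℝ => (1 : ℝ)) =o[atTop] Real.log :=
    Real.isLittleO_const_log_atTop
  have hx : (fun x : ℝ => x) =o[atTop] fun x => x * Real.log x := by
    simpa using (isBigO_refl (fun x : ℝ => x) atTop).mul_isLittleO h1
  have hD : (fun x : ℝ => Real.log x ^ 2) =o[atTop] fun x => x * Real.log x := by
    simpa [sq] using Real.isLittleO_log_id_atTop.mul_isBigO (isBigO_refl Real.log atTop)
  have hC : Real.log =o[atTop] fun x => x * Real.log x := Real.isLittleO_log_id_atTop.trans hx
  have hA : (fun _ : ℝ => (1 : ℝ)) =o[atTop] fun x => x * Real.log x := h1.trans hC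
  have := (((hA.const_mul_left A).add (hx.const_mul_left B)).add (hC.const_mul_left C)).add
    (hD.const_mul_left D)
  filter_upwards [this.bound hε, eventually_ge_atTop 1] with x hx1 hx2
  rw [Real.norm_of_nonneg (mul_nonneg (by linarith) (Real.log_nonneg hx2))] at hx1
  have := (Real.le_norm_self _).trans hx1
  linarith

/-- The exponent of `upperMain` exceeds that of the bound for the average error probability by
`Ω (ln ρ) (ln ln ρ) / 4 + O(ln ρ)`. -/
theorem eventually_avgPEP_le_upperMain {L N M : ℕ} (hN : 0 < N) (hM : 0 < M)
    (μ : Fin N → Fin M → ℝ)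
    {σ : Fin N → Fin M → ℝ} (hσ : ∀ i j, 0 < σ i j) {X X' : Matrix (Fin L) (Fin N) ℝ}
    (hP : HasFullCover ((X - X')ᵀ * (X - X'))) :
    ∀ᶠ ρ in atTop, avgPEP μ σ X X' ρ ≤ upperMain μ σ ((X - X')ᵀ * (X - X')) ρ := by
  obtain ⟨K, hK⟩ := exists_avgPEP_le_exp hN μ hσ hP
  have hC := hP.constU_pos (μ := μ) hN hM hσ
  have : Nonempty (Fin N) := ⟨⟨0, hN⟩⟩
  have : Nonempty (Fin M) := ⟨⟨0, hM⟩⟩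
  have hO : 0 < OmTot σ := Finset.sum_pos (fun i _ => Finset.sum_pos
    (fun j _ => inv_pos.2 (pow_pos (hσ i j) 2)) Finset.univ_nonempty) Finset.univ_nonempty
  unfold upperMain
  set C := constU μ σ ((X - X')ᵀ * (X - X'))
  set κ := 1 / 2 * Real.log (∏ i, coverLength ((X - X')ᵀ * (X - X')) i ^ Om σ i)
        - 1 / 2 * OmTot σ * Real.log (N * OmTot σ) - 1 / 4 * OmTTot μ σ
  filter_upwards [hK, eventually_gt_atTop 1,
    Real.tendsto_log_atTop.eventually (eventually_le_mul_log (Real.log (Real.sqrt 2) - Real.log C)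
      (K - κ) (2 * κ + M * N) (OmTot σ / 2) (show 0 < OmTot σ / 4 by positivity))] with ρ h1 hρ h2
  have hρ0 : 0 < ρ := one_pos.trans hρ
  have hl : 0 < Real.log ρ := Real.log_pos hρ
  refine h1.trans ?_
  have hlog : Real.log (ρ / Real.log ρ ^ 2) = Real.log ρ - 2 * Real.log (Real.log ρ) := by
    rw [Real.log_div hρ0.ne' (by positivity), Real.log_pow]; push_cast; ring
  have hsq : Real.sqrt 2 = Real.exp (Real.log (Real.sqrt 2)) :=
    (Real.exp_log (by positivity)).symm
  rw [Real.rpow_def_of_pos (by positivity), Real.rpow_def_of_pos hl, hlog, ← Real.exp_log hC, hsq]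
  simp only [← Real.exp_add]
  rw [Real.exp_le_exp]
  linarith

end OWC

namespace OWC

/-! ### Lower bound for the average error probability -/

/-- The error probability is bounded below by a positive constant on the channels with all entries
of order `ρ ^ (-1 / 2)`, uniformly in `ρ`. -/
theorem exists_pos_le_condPEP {L N M : ℕ} (X X' : Matrix (Fin L) (Fin N) ℝ)
    (g : Fin N → Fin M → ℝ) :
    ∃ q : ℝ, 0 < q ∧ ∀ ρ : ℝ, 0 < ρ → ∀ H : Fin N → Fin M → ℝ,
      (∀ i j, 0 ≤ H i j ∧ H i j ≤ Real.exp (g i j - Real.log ρ / 2)) → q ≤ condPEP X X' ρ H := by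
  set P := (X - X')ᵀ * (X - X')
  set D := (N : ℝ)⁻¹ * ∑ j, ∑ i, ∑ k, Real.exp (g i j) * (|P i k| * Real.exp (g k j))
  refine ⟨gaussianQ (Real.sqrt D / 2), gaussianQ_pos _, fun ρ hρ H hH => gaussianQ_antitone ?_⟩
  refine div_le_div_of_nonneg_right (Real.sqrt_le_sqrt ?_) two_pos.le
  have hexp : ρ * (Real.exp (-(Real.log ρ / 2)) * Real.exp (-(Real.log ρ / 2))) = 1 := by
    rw [← Real.exp_add, show -(Real.log ρ / 2) + -(Real.log ρ / 2) = -Real.log ρ by ring,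
      Real.exp_neg, Real.exp_log hρ, mul_inv_cancel₀ hρ.ne']
  rw [div_eq_mul_inv, mul_comm ρ, mul_assoc, Finset.mul_sum]
  refine mul_le_mul_of_nonneg_left (Finset.sum_le_sum fun j _ => ?_) (by positivity)
  simp only [dotProduct, Matrix.mulVec, Finset.mul_sum]
  refine Finset.sum_le_sum fun i _ => Finset.sum_le_sum fun k _ => ?_
  have hi := hH i j
  have hk := hH k j
  rw [sub_eq_add_neg, Real.exp_add] at hi hk
  calc ρ * (H i j * (P i k * H k j)) = ρ * (P i k * (H i j * H k j)) := by ring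
    _ ≤ ρ * (|P i k| * ((Real.exp (g i j) * Real.exp (-(Real.log ρ / 2))) *
          (Real.exp (g k j) * Real.exp (-(Real.log ρ / 2))))) := by
        refine mul_le_mul_of_nonneg_left ?_ hρ.le
        refine (mul_le_mul_of_nonneg_right (le_abs_self _) (mul_nonneg hi.1 hk.1)).trans ?_
        exact mul_le_mul_of_nonneg_left (mul_le_mul hi.2 hk.2 hk.1 (by positivity)) (abs_nonneg _)
    _ = Real.exp (g i j) * (|P i k| * Real.exp (g k j)) *
          (ρ * (Real.exp (-(Real.log ρ / 2)) * Real.exp (-(Real.log ρ / 2)))) := by ring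
    _ = _ := by rw [hexp, mul_one]

theorem tendsto_lowerArg {N M : ℕ} (μ : Fin N → Fin M → ℝ) {σ : Fin N → Fin M → ℝ}
    (P : Matrix (Fin N) (Fin N) ℝ) {i : Fin N} {j : Fin M} (hσ : 0 < σ i j) :
    Tendsto (fun ρ => lowerArg μ σ P ρ i j) atTop atTop := by
  unfold lowerArg
  refine Tendsto.atTop_div_const (by positivity) ?_
  exact tendsto_atTop_add_const_right _ _
    (tendsto_atTop_add_const_right _ _ Real.tendsto_log_atTop)

/-- The average error probability exceeds a multiple of `∏ exp (-(x_ij - 1) ^ 2 / 2)`, where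
`x_ij = lowerArg μ σ P ρ i j`. -/
theorem exists_pos_mul_le_avgPEP {L N M : ℕ} (μ : Fin N → Fin M → ℝ)
    {σ : Fin N → Fin M → ℝ} (hσ : ∀ i j, 0 < σ i j) (X X' : Matrix (Fin L) (Fin N) ℝ)
    (P : Matrix (Fin N) (Fin N) ℝ) :
    ∃ q : ℝ, 0 < q ∧ ∀ᶠ ρ in atTop,
      q * Real.exp (∑ i, ∑ j, -(lowerArg μ σ P ρ i j - 1) ^ 2 / 2) ≤ avgPEP μ σ X X' ρ := by
  obtain ⟨q, hq, hle⟩ := exists_pos_le_condPEP X X'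
    (fun (i : Fin N) (j : Fin M) => 2 * σ i j - Real.log (maxEigenvalue P))
  refine ⟨q * ∏ _i : Fin N, ∏ _j : Fin M, (Real.sqrt (2 * Real.pi))⁻¹, by positivity, ?_⟩
  have hx : ∀ᶠ ρ in atTop, ∀ i j, 2 ≤ lowerArg μ σ P ρ i j :=
    eventually_all.2 fun i => eventually_all.2 fun j =>
      (tendsto_lowerArg μ P (hσ i j)).eventually_ge_atTop 2
  filter_upwards [hx, eventually_gt_atTop 0] with ρ hx hρ
  set t : Fin N → Fin M → ℝ := fun i j => μ i j - σ i j * (lowerArg μ σ P ρ i j - 2) with ht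
  set S : Set (Fin N → Fin M → ℝ) :=
    Set.univ.pi fun i => Set.univ.pi fun j => Set.Ioc 0 (Real.exp (t i j)) with hS
  have hSm : MeasurableSet S :=
    MeasurableSet.univ_pi fun i => MeasurableSet.univ_pi fun j => measurableSet_Ioc
  have hteq : ∀ i j, t i j = 2 * σ i j - Real.log (maxEigenvalue P) - Real.log ρ / 2 := by
    intro i j
    have := (hσ i j).ne'
    simp only [ht, lowerArg]
    field_simp
    ring
  have hmass : ∏ i, ∏ j, (Real.sqrt (2 * Real.pi))⁻¹ *
      Real.exp (-(lowerArg μ σ P ρ i j - 1) ^ 2 / 2) ≤ (channelLaw μ σ).real S := by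
    rw [hS, channelLaw_real_rectangle]
    exact Finset.prod_le_prod (fun i _ => by positivity) fun i _ =>
      Finset.prod_le_prod (fun j _ => by positivity) fun j _ =>
        le_gaussianReal_Iic (μ i j) (hσ i j) (hx i j)
  calc _ = q * ∏ i, ∏ j, (Real.sqrt (2 * Real.pi))⁻¹ *
      Real.exp (-(lowerArg μ σ P ρ i j - 1) ^ 2 / 2) := by
        simp only [Finset.prod_mul_distrib, Real.exp_sum]
        ring
    _ ≤ q * (channelLaw μ σ).real S := mul_le_mul_of_nonneg_left hmass hq.le
    _ = ∫ _ in S, q ∂(channelLaw μ σ) := by rw [setIntegral_const, smul_eq_mul, mul_comm]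
    _ ≤ ∫ H in S, condPEP X X' ρ H ∂(channelLaw μ σ) := by
        refine setIntegral_mono_on (integrable_const _).integrableOn
          (integrable_condPEP μ σ X X' ρ).integrableOn hSm fun H hH => hle ρ hρ H fun i j => ?_
        have := hH i trivial j trivial
        exact ⟨this.1.le, hteq i j ▸ this.2⟩
    _ ≤ avgPEP μ σ X X' ρ := setIntegral_le_integral (integrable_condPEP μ σ X X' ρ)
        (ae_of_all _ fun _ => gaussianQ_nonneg _)

theorem eventually_lowerBound_le_avgPEP {L N M : ℕ} (hN : 0 < N) (hM : 0 < M)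
    (μ : Fin N → Fin M → ℝ) {σ : Fin N → Fin M → ℝ} (hσ : ∀ i j, 0 < σ i j)
    (X X' : Matrix (Fin L) (Fin N) ℝ) (P : Matrix (Fin N) (Fin N) ℝ) :
    ∀ᶠ ρ in atTop, lowerBound μ σ P ρ ≤ avgPEP μ σ X X' ρ := by
  obtain ⟨q, hq, hle⟩ := exists_pos_mul_le_avgPEP μ hσ X X' P
  have hx : ∀ᶠ ρ in atTop, ∀ i j, 1 ≤ lowerArg μ σ P ρ i j :=
    eventually_all.2 fun i => eventually_all.2 fun j =>
      (tendsto_lowerArg μ P (hσ i j)).eventually_ge_atTop 1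
  have hbig : ∀ᶠ ρ in atTop, |constL μ σ P| / q ≤
      Real.exp (lowerArg μ σ P ρ ⟨0, hN⟩ ⟨0, hM⟩ - 1 / 2) :=
    (Real.tendsto_exp_atTop.comp (tendsto_atTop_add_const_right _ (-(1 / 2))
      (tendsto_lowerArg μ P (hσ _ _)))).eventually_ge_atTop _
  filter_upwards [hle, hx, hbig] with ρ hle hx hbig
  refine le_trans ?_ hle
  have hfac : ∀ i j, 0 ≤ (1 - (lowerArg μ σ P ρ i j ^ 2)⁻¹) / lowerArg μ σ P ρ i j ∧
      (1 - (lowerArg μ σ P ρ i j ^ 2)⁻¹) / lowerArg μ σ P ρ i j ≤ 1 := by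
    intro i j
    have h1 := hx i j
    have h2 : (lowerArg μ σ P ρ i j ^ 2)⁻¹ ≤ 1 := inv_le_one_of_one_le₀ (one_le_pow₀ h1)
    have h3 : 0 ≤ (lowerArg μ σ P ρ i j ^ 2)⁻¹ := by positivity
    refine ⟨div_nonneg (by linarith) (by linarith), ?_⟩
    rw [div_le_one (by linarith)]
    linarith
  have hprod : |∏ j, ∏ i, (1 - (lowerArg μ σ P ρ i j ^ 2)⁻¹) / lowerArg μ σ P ρ i j| ≤ 1 := by
    rw [abs_of_nonneg (Finset.prod_nonneg fun j _ => Finset.prod_nonneg fun i _ => (hfac i j).1)]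
    exact Finset.prod_le_one (fun j _ => Finset.prod_nonneg fun i _ => (hfac i j).1) fun j _ =>
      Finset.prod_le_one (fun i _ => (hfac i j).1) fun i _ => (hfac i j).2
  have hexp : -∑ j, ∑ i, (Real.log ρ + 2 * Real.log (maxEigenvalue P) + 2 * μ i j) ^ 2 /
      (8 * σ i j ^ 2) = ∑ i, ∑ j, -(lowerArg μ σ P ρ i j - 1) ^ 2 / 2 -
        ∑ i, ∑ j, (lowerArg μ σ P ρ i j - 1 / 2) := by
    rw [Finset.sum_comm]
    simp only [← Finset.sum_neg_distrib, ← Finset.sum_sub_distrib]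
    refine Finset.sum_congr rfl fun i _ => Finset.sum_congr rfl fun j _ => ?_
    have e : (Real.log ρ + 2 * Real.log (maxEigenvalue P) + 2 * μ i j) ^ 2 / (8 * σ i j ^ 2) =
        lowerArg μ σ P ρ i j ^ 2 / 2 := by
      rw [lowerArg, div_pow, div_div]; congr 1; ring
    rw [e]
    ring
  -- the exponents differ by `∑ (x_ij - 1 / 2)`, which is unbounded and absorbs the constants
  have hsum : lowerArg μ σ P ρ ⟨0, hN⟩ ⟨0, hM⟩ - 1 / 2 ≤
      ∑ i, ∑ j, (lowerArg μ σ P ρ i j - 1 / 2) := by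
    have h0 : ∀ i j, 0 ≤ lowerArg μ σ P ρ i j - 1 / 2 := fun i j => by linarith [hx i j]
    exact (Finset.single_le_sum (f := fun j => lowerArg μ σ P ρ ⟨0, hN⟩ j - 1 / 2)
      (fun j _ => h0 _ j) (Finset.mem_univ (⟨0, hM⟩ : Fin M))).trans
      (Finset.single_le_sum (f := fun i => ∑ j, (lowerArg μ σ P ρ i j - 1 / 2))
        (fun i _ => Finset.sum_nonneg fun j _ => h0 i j) (Finset.mem_univ (⟨0, hN⟩ : Fin N)))
  have hC : |constL μ σ P| ≤ q * Real.exp (∑ i, ∑ j, (lowerArg μ σ P ρ i j - 1 / 2)) := by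
    rw [div_le_iff₀' hq] at hbig
    exact hbig.trans (mul_le_mul_of_nonneg_left (Real.exp_le_exp.2 hsum) hq.le)
  rw [lowerBound, hexp, Real.exp_sub]
  calc _ ≤ |constL μ σ P| * (Real.exp (∑ i, ∑ j, -(lowerArg μ σ P ρ i j - 1) ^ 2 / 2) /
        Real.exp (∑ i, ∑ j, (lowerArg μ σ P ρ i j - 1 / 2))) := by
        refine mul_le_mul_of_nonneg_right ?_ (by positivity)
        refine (le_abs_self _).trans ?_
        rw [abs_mul]
        exact mul_le_of_le_one_right (abs_nonneg _) hprod
    _ ≤ q * Real.exp (∑ i, ∑ j, (lowerArg μ σ P ρ i j - 1 / 2)) *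
        (Real.exp (∑ i, ∑ j, -(lowerArg μ σ P ρ i j - 1) ^ 2 / 2) /
          Real.exp (∑ i, ∑ j, (lowerArg μ σ P ρ i j - 1 / 2))) :=
        mul_le_mul_of_nonneg_right hC (by positivity)
    _ = _ := by
        rw [mul_assoc, mul_div_cancel₀ _ (Real.exp_ne_zero _)]

end OWC

theorem mainTheorem3 (L N M : ℕ) (hN : 0 < N) (hM : 0 < M)
    (μ σ : Fin N → Fin M → ℝ) (hσ : ∀ i j, 0 < σ i j)
    (𝒳 : Set (Matrix (Fin L) (Fin N) ℝ)) (h𝒳 : ∀ X ∈ 𝒳, ∀ l i, 0 ≤ X l i)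
    (hcover : ∀ X ∈ 𝒳, ∀ X' ∈ 𝒳, X ≠ X' → OWC.HasFullCover ((X - X')ᵀ * (X - X'))) :
    ∀ X ∈ 𝒳, ∀ X' ∈ 𝒳, X ≠ X' →
      ∃ r : ℝ → ℝ, r =o[atTop] (fun ρ => OWC.remainderScale σ ρ) ∧
        ∀ᶠ ρ in atTop,
          OWC.lowerBound μ σ ((X - X')ᵀ * (X - X')) ρ ≤ OWC.avgPEP μ σ X X' ρ ∧
          OWC.avgPEP μ σ X X' ρ ≤ OWC.upperMain μ σ ((X - X')ᵀ * (X - X')) ρ + r ρ := by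
  intro X hX X' hX' hne
  have hP := hcover X hX X' hX' hne
  refine ⟨0, isLittleO_zero _ _, ?_⟩
  filter_upwards [OWC.eventually_lowerBound_le_avgPEP hN hM μ hσ X X' ((X - X')ᵀ * (X - X')),
    OWC.eventually_avgPEP_le_upperMain hN hM μ hσ hP] with ρ h1 h2
  exact ⟨h1, by simpa using h2⟩
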